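/- **Theorem (Sufficient polyconvexity criterion based on principal stretches).** Write $\mathbb{R}_\infty=\mathbb{R}\cup\{\infty\}$. A function $\Psi\colon\mathbb{R}^{3\times3}\to\mathbb{R}_\infty$ is called *polyconvex* if there is a convex and lower semicontinuous function $\widehat\Psi\colon\mathbb{R}^{3\times3}\times\mathbb{R}^{3\times3}\times\mathbb{R}\to\mathbb{R}_\infty$ with $\Psi(F)=\widehat\Psi(F,\operatorname{cof}F,\det F)$ for all $F\in\mathbb{R}^{3\times3}$, where $\operatorname{cof}F$ denotes the cofactor matrix of $F$. Let $\Psi_{\mathrm{Ball}}\colon\mathbb{R}^6\times[0,\infty)\to\mathbb{R}_\infty$ be convex, lower semicontinuous, and non-decreasing in each of its first six arguments. Suppose that the function $\breve\Psi\colon[0,\infty)^3\to\mathbb{R}_\infty$ given by $$\breve\Psi(\lambda_1,\lambda_2,\lambda_3)=\Psi_{\mathrm{Ball}}(\lambda_1,\lambda_2,\lambda_3,\lambda_2\lambda_3,\lambda_1\lambda_3,\lambda_1\lambda_2,\lambda_1\lambda_2\lambda_3)$$ is invariant under all permutations of $(\lambda_1,\lambda_2,\lambda_3)$. Let $\Psi\colon\mathbb{R}^{3\times3}\to\mathbb{R}_\infty$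 be given by $$\Psi(F)=\begin{cases}\breve\Psi(\lambda_1,\lambda_2,\lambda_3)&\text{if }\det F\ge0,\\ \infty&\text{if }\det F<0,\end{cases}$$ where $\lambda_1,\lambda_2,\lambda_3\ge0$ are the principal stretches (singular values, counted with multiplicity) of $F$, that is, the square roots of the eigenvalues of $F^{\mathsf T}F$. Then $\Psi$ is polyconvex. -/

import Mathlib

open scoped Matrix

/-- Convexity on a set `s` of an extended-real-valued function with values in
`ℝ ∪ {∞} = WithTop ℝ`. Only weights `0 < a`, `0 < b` are tested, so that no product `0 * ∞`
occurs; `a * ∞ = ∞` for `0 < a`. -/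
def ExtConvexOn {E : Type*} [AddCommMonoid E] [Module ℝ E] (s : Set E) (f : E → WithTop ℝ) :
    Prop :=
  Convex ℝ s ∧ ∀ x ∈ s, ∀ y ∈ s, ∀ a b : ℝ, 0 < a → 0 < b → a + b = 1 →
    f (a • x + b • y) ≤ (a : WithTop ℝ) * f x + (b : WithTop ℝ) * f y

/-- The cofactor matrix (the matrix of signed `2 × 2` minors), the transpose of the adjugate. -/
def cofactorMatrix (F : Matrix (Fin 3) (Fin 3) ℝ) : Matrix (Fin 3) (Fin 3) ℝ :=
  F.adjugateᵀ

/-- `Ψ : ℝ^{3×3} → ℝ ∪ {∞}` is polyconvex: `Ψ F = Φ (F, cof F, det F)` for some convex and lower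
semicontinuous function `Φ : ℝ^{3×3} × ℝ^{3×3} × ℝ → ℝ ∪ {∞}`. -/
def IsPolyconvex (Ψ : Matrix (Fin 3) (Fin 3) ℝ → WithTop ℝ) : Prop :=
  ∃ Φ : Matrix (Fin 3) (Fin 3) ℝ × Matrix (Fin 3) (Fin 3) ℝ × ℝ → WithTop ℝ,
    ExtConvexOn Set.univ Φ ∧ LowerSemicontinuous Φ ∧
      ∀ F, Ψ F = Φ (F, cofactorMatrix F, F.det)

/-- The principal stretches (singular values) of `F`, with multiplicity: the square roots of the
eigenvalues of `Fᵀ F` (over `ℝ` the conjugate transpose is the transpose). -/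
noncomputable def principalStretches (F : Matrix (Fin 3) (Fin 3) ℝ) : Fin 3 → ℝ :=
  fun i => Real.sqrt ((Matrix.isHermitian_conjTranspose_mul_self F).eigenvalues i)

/-- The vector `(l₂ l₃, l₁ l₃, l₁ l₂)` of pairwise products. -/
def pairProducts (l : Fin 3 → ℝ) : Fin 3 → ℝ :=
  ![l 1 * l 2, l 0 * l 2, l 0 * l 1]

/-- The set `ℝ³ × ℝ³ × [0, ∞)`, that is `ℝ⁶ × [0, ∞)`. -/
def ballDomain : Set ((Fin 3 → ℝ) × (Fin 3 → ℝ) × ℝ) :=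
  {p | 0 ≤ p.2.2}

/-! Extend `ΨBall` by `∞` and take for `Φ (F, G, δ)` the supremum, over orthogonal `Q` and `R`, of
its values at `(diag (Q F R), diag (cof Q G cof R), δ)`. Each term is a convex lower semicontinuous
function after a linear map, so `Φ` is convex and lower semicontinuous.

It remains to evaluate `Φ` at `(F, cof F, det F)` when `det F ≥ 0`. The singular value decomposition
gives `Q`, `R` that diagonalise `F`, so the value `Ψbreve l` at the stretches `l` is attained. No
other pair exceeds it: by `diag_mul_diagonal_mul_le` and `meanSquares_cofactorMatrix`, the two
diagonals are bounded by `B l` and `B (pairProducts l)` with the same doubly stochastic `B`.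
Monotonicity, Birkhoff's theorem, convexity and permutation invariance
(`ExtConvexOn.le_of_mem_doublyStochastic`) then bound the term by `Ψbreve l`. -/

/-! ### Convexity and semicontinuity with values in `ℝ ∪ {∞}`. -/

section ExtendedConvexity

/-- Sublevel sets of an extended-real-valued convex function are convex. -/
theorem ExtConvexOn.convex_le {E : Type*} [AddCommMonoid E] [Module ℝ E] {s : Set E}
    {f : E → WithTop ℝ} (hf : ExtConvexOn s f) (c : WithTop ℝ) :
    Convex ℝ {x | x ∈ s ∧ f x ≤ c} := by
  rw [convex_iff_forall_pos]
  rintro x ⟨hxs, hx⟩ y ⟨hys, hy⟩ a b ha hb hab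
  refine ⟨hf.1 hxs hys ha.le hb.le hab, (hf.2 x hxs y hys a b ha hb hab).trans ?_⟩
  induction c using WithTop.recTopCoe with
  | top => exact le_top
  | coe c =>
    lift f x to ℝ using ne_top_of_le_ne_top WithTop.coe_ne_top hx with u
    lift f y to ℝ using ne_top_of_le_ne_top WithTop.coe_ne_top hy with v
    norm_cast at hx hy ⊢
    calc a * u + b * v ≤ a * c + b * c := by gcongr
      _ = c := by rw [← add_mul, hab, one_mul]

theorem WithTop.coe_mul_le_coe_mul_of_pos {a : ℝ} (ha : 0 < a) {u v : WithTop ℝ} (h : u ≤ v) :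
    (a : WithTop ℝ) * u ≤ (a : WithTop ℝ) * v := by
  induction v using WithTop.recTopCoe with
  | top => rw [WithTop.mul_top (by exact_mod_cast ha.ne')]; exact le_top
  | coe v =>
    lift u to ℝ using ne_top_of_le_ne_top WithTop.coe_ne_top h with u
    norm_cast at h ⊢
    gcongr

/-- The pointwise supremum of a nonempty family of extended-real-valued convex functions is
convex. -/
theorem ExtConvexOn.iSup {ι E : Type*} [Nonempty ι] [AddCommMonoid E] [Module ℝ E] {s : Set E}
    {f : ι → E → WithTop ℝ} (hf : ∀ i, ExtConvexOn s (f i)) :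
    ExtConvexOn s fun x => ⨆ i, f i x := by
  -- `WithTop ℝ` has no least element, so `⨆` is a genuine supremum only because the family is
  -- nonempty.
  have hlub (x : E) : IsLUB (Set.range fun i => f i x) (⨆ i, f i x) :=
    WithTop.isLUB_sSup' (Set.range_nonempty _)
  refine ⟨(hf (Classical.arbitrary ι)).1, fun x hx y hy a b ha hb hab => (hlub _).2 ?_⟩
  rintro _ ⟨i, rfl⟩
  exact ((hf i).2 x hx y hy a b ha hb hab).trans <| add_le_add
    (WithTop.coe_mul_le_coe_mul_of_pos ha ((hlub x).1 ⟨i, rfl⟩))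
    (WithTop.coe_mul_le_coe_mul_of_pos hb ((hlub y).1 ⟨i, rfl⟩))

theorem lowerSemicontinuous_iSup_withTop {ι E : Type*} [Nonempty ι] [TopologicalSpace E]
    {f : ι → E → WithTop ℝ} (hf : ∀ i, LowerSemicontinuous (f i)) :
    LowerSemicontinuous fun x => ⨆ i, f i x := by
  have hlub (x : E) : IsLUB (Set.range fun i => f i x) (⨆ i, f i x) :=
    WithTop.isLUB_sSup' (Set.range_nonempty _)
  intro x c hc
  obtain ⟨_, ⟨i, rfl⟩, hi⟩ := (lt_isLUB_iff (hlub x)).1 hc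
  filter_upwards [hf i x c hi] with y hy
  exact hy.trans_le ((hlub y).1 ⟨i, rfl⟩)

open Classical in
/-- The extension of `f` by `∞` outside `s`. -/
noncomputable def extendByTop {E : Type*} (s : Set E) (f : E → WithTop ℝ) (x : E) : WithTop ℝ :=
  if x ∈ s then f x else ⊤

theorem ExtConvexOn.extendByTop {E : Type*} [AddCommMonoid E] [Module ℝ E] {s : Set E}
    {f : E → WithTop ℝ} (hf : ExtConvexOn s f) : ExtConvexOn Set.univ (extendByTop s f) := by
  refine ⟨convex_univ, fun x _ y _ a b ha hb hab => ?_⟩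
  by_cases hx : x ∈ s
  · by_cases hy : y ∈ s
    · simpa [_root_.extendByTop, hx, hy, hf.1 hx hy ha.le hb.le hab] using
        hf.2 x hx y hy a b ha hb hab
    · have hb' : (b : WithTop ℝ) * ⊤ = ⊤ := WithTop.mul_top (by exact_mod_cast hb.ne')
      simp [_root_.extendByTop, hy, hb']
  · have ha' : (a : WithTop ℝ) * ⊤ = ⊤ := WithTop.mul_top (by exact_mod_cast ha.ne')
    simp [_root_.extendByTop, hx, ha']

theorem LowerSemicontinuousOn.extendByTop {E : Type*} [TopologicalSpace E] {s : Set E}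
    (hs : IsClosed s) {f : E → WithTop ℝ} (hf : LowerSemicontinuousOn f s) :
    LowerSemicontinuous (extendByTop s f) := by
  intro x c hc
  by_cases hx : x ∈ s
  · have h := hf x hx c (by simpa [_root_.extendByTop, hx] using hc)
    filter_upwards [eventually_nhdsWithin_iff.1 h] with y hy
    by_cases hys : y ∈ s
    · simpa [_root_.extendByTop, hys] using hy hys
    · simpa [_root_.extendByTop, hys] using hc.trans_le le_top
  · filter_upwards [hs.isOpen_compl.mem_nhds hx] with y hy
    have hys : y ∉ s := hy
    simpa [_root_.extendByTop, hys] using hc.trans_le le_top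

theorem ExtConvexOn.comp_linearMap {E E' : Type*} [AddCommMonoid E] [Module ℝ E]
    [AddCommMonoid E'] [Module ℝ E'] {f : E' → WithTop ℝ} (hf : ExtConvexOn Set.univ f)
    (T : E →ₗ[ℝ] E') : ExtConvexOn Set.univ (f ∘ T) :=
  ⟨convex_univ, fun x _ y _ a b ha hb hab => by
    simpa using hf.2 (T x) trivial (T y) trivial a b ha hb hab⟩

/-- A function on `Fin n → ℝ` which is monotone in each coordinate is monotone. -/
theorem monotone_of_monotone_update {n : ℕ} {α : Type*} [Preorder α] {f : (Fin n → ℝ) → α}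
    (hf : ∀ x i, Monotone fun t : ℝ => f (Function.update x i t)) : Monotone f := by
  intro x y hxy
  have key (s : Finset (Fin n)) : f x ≤ f (s.piecewise y x) := by
    induction s using Finset.induction_on with
    | empty => simp
    | insert i s hi ih =>
      refine ih.trans ?_
      rw [Finset.piecewise_insert]
      calc f (s.piecewise y x)
          = f (Function.update (s.piecewise y x) i (x i)) := by
            congr 1
            rw [eq_comm, Function.update_eq_self_iff]
            simp [hi]
        _ ≤ _ := hf _ i (hxy i)
  simpa using key Finset.univ

end ExtendedConvexity

/-! ### Cofactors, orthogonal matrices and singular values. -/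

section Orthogonal

theorem cofactorMatrix_mul (A B : Matrix (Fin 3) (Fin 3) ℝ) :
    cofactorMatrix (A * B) = cofactorMatrix A * cofactorMatrix B := by
  simp [cofactorMatrix, Matrix.adjugate_mul_distrib]

theorem cofactorMatrix_diagonal (l : Fin 3 → ℝ) :
    cofactorMatrix (Matrix.diagonal l) = Matrix.diagonal (pairProducts l) := by
  ext i j
  rw [cofactorMatrix, Matrix.adjugate_fin_three]
  fin_cases i <;> fin_cases j <;> simp [pairProducts]

/-- A permutation of three indices preserves or reverses their cyclic order, so it carries the two
indices other than `i` to the two other than `σ i`. -/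
theorem pairProducts_comp (l : Fin 3 → ℝ) (σ : Equiv.Perm (Fin 3)) :
    pairProducts (l ∘ σ) = pairProducts l ∘ σ := by
  have h0 : ∀ i, pairProducts l i = l (i + 1) * l (i + 2) := by
    intro i; fin_cases i <;> simp [pairProducts, mul_comm]
  have h1 : ∀ i, pairProducts (l ∘ σ) i = l (σ (i + 1)) * l (σ (i + 2)) := by
    intro i; fin_cases i <;> simp [pairProducts, mul_comm]
  have h2 : ∀ (σ : Equiv.Perm (Fin 3)) (i : Fin 3),
      (σ (i + 1) = σ i + 1 ∧ σ (i + 2) = σ i + 2) ∨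
      (σ (i + 1) = σ i + 2 ∧ σ (i + 2) = σ i + 1) := by decide
  funext i
  rw [h1, Function.comp_apply, h0]
  rcases h2 σ i with ⟨h, h'⟩ | ⟨h, h'⟩ <;> rw [h, h']
  exact mul_comm _ _

theorem det_sq_of_mem_orthogonalGroup {Q : Matrix (Fin 3) (Fin 3) ℝ}
    (hQ : Q ∈ Matrix.orthogonalGroup (Fin 3) ℝ) : Q.det ^ 2 = 1 := by
  have h := congrArg Matrix.det ((Matrix.mem_orthogonalGroup_iff (Fin 3) ℝ).1 hQ)
  simpa [sq, Matrix.star_eq_conjTranspose] using h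

theorem cofactorMatrix_of_mem_orthogonalGroup {Q : Matrix (Fin 3) (Fin 3) ℝ}
    (hQ : Q ∈ Matrix.orthogonalGroup (Fin 3) ℝ) : cofactorMatrix Q = Q.det • Q := by
  have h : Q * star Q = 1 := (Matrix.mem_orthogonalGroup_iff (Fin 3) ℝ).1 hQ
  have h' : Q.adjugate = Q.det • star Q := by
    calc Q.adjugate = Q.adjugate * (Q * star Q) := by rw [h, mul_one]
      _ = Q.det • star Q := by rw [← mul_assoc, Matrix.adjugate_mul]; simp
  rw [cofactorMatrix, h']
  ext i j
  simp [Matrix.star_eq_conjTranspose]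

theorem sum_sq_row_of_mem_orthogonalGroup {Q : Matrix (Fin 3) (Fin 3) ℝ}
    (hQ : Q ∈ Matrix.orthogonalGroup (Fin 3) ℝ) (i : Fin 3) : ∑ j, Q i j ^ 2 = 1 := by
  have h := congrFun (congrFun ((Matrix.mem_orthogonalGroup_iff (Fin 3) ℝ).1 hQ) i) i
  simpa [Matrix.mul_apply, sq, Matrix.star_eq_conjTranspose] using h

theorem sum_sq_col_of_mem_orthogonalGroup {Q : Matrix (Fin 3) (Fin 3) ℝ}
    (hQ : Q ∈ Matrix.orthogonalGroup (Fin 3) ℝ) (j : Fin 3) : ∑ i, Q i j ^ 2 = 1 := by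
  have h := congrFun (congrFun ((Matrix.mem_orthogonalGroup_iff' (Fin 3) ℝ).1 hQ) j) j
  simpa [Matrix.mul_apply, sq, Matrix.star_eq_conjTranspose] using h

/-- The doubly stochastic matrix `((Q i j)² + (R j i)²) / 2` of two orthogonal matrices. -/
noncomputable def meanSquares (Q R : Matrix (Fin 3) (Fin 3) ℝ) : Matrix (Fin 3) (Fin 3) ℝ :=
  Matrix.of fun i j => (Q i j ^ 2 + R j i ^ 2) / 2

theorem meanSquares_mem_doublyStochastic {Q R : Matrix (Fin 3) (Fin 3) ℝ}
    (hQ : Q ∈ Matrix.orthogonalGroup (Fin 3) ℝ) (hR : R ∈ Matrix.orthogonalGroup (Fin 3) ℝ) :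
    meanSquares Q R ∈ doublyStochastic ℝ (Fin 3) := by
  rw [mem_doublyStochastic_iff_sum]
  refine ⟨fun i j => ?_, fun i => ?_, fun j => ?_⟩
  · simp only [meanSquares, Matrix.of_apply]; positivity
  · simp only [meanSquares, Matrix.of_apply]
    rw [← Finset.sum_div, Finset.sum_add_distrib, sum_sq_row_of_mem_orthogonalGroup hQ,
      sum_sq_col_of_mem_orthogonalGroup hR]
    norm_num
  · simp only [meanSquares, Matrix.of_apply]
    rw [← Finset.sum_div, Finset.sum_add_distrib, sum_sq_col_of_mem_orthogonalGroup hQ,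
      sum_sq_row_of_mem_orthogonalGroup hR]
    norm_num

/-- Termwise `2 Q i j * R j i ≤ (Q i j)² + (R j i)²`, weighted by `l j ≥ 0`. -/
theorem diag_mul_diagonal_mul_le (Q R : Matrix (Fin 3) (Fin 3) ℝ) {l : Fin 3 → ℝ}
    (hl : ∀ i, 0 ≤ l i) : (Q * Matrix.diagonal l * R).diag ≤ meanSquares Q R *ᵥ l := by
  intro i
  rw [Matrix.diag_apply, Matrix.mul_apply]
  simp only [Matrix.mul_diagonal, Matrix.mulVec, dotProduct,
    meanSquares, Matrix.of_apply]
  refine Finset.sum_le_sum fun j _ => ?_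
  nlinarith [mul_nonneg (hl j) (sq_nonneg (Q i j - R j i))]

/-- The cofactor matrix of an orthogonal matrix is `±` that matrix, and squares ignore the sign.
Hence one doubly stochastic matrix serves for both `F` and `cof F`. -/
theorem meanSquares_cofactorMatrix {Q R : Matrix (Fin 3) (Fin 3) ℝ}
    (hQ : Q ∈ Matrix.orthogonalGroup (Fin 3) ℝ) (hR : R ∈ Matrix.orthogonalGroup (Fin 3) ℝ) :
    meanSquares (cofactorMatrix Q) (cofactorMatrix R) = meanSquares Q R := by
  ext i j
  simp [meanSquares, cofactorMatrix_of_mem_orthogonalGroup hQ,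
    cofactorMatrix_of_mem_orthogonalGroup hR, mul_pow, det_sq_of_mem_orthogonalGroup hQ,
    det_sq_of_mem_orthogonalGroup hR]

theorem transpose_mem_orthogonalGroup {Q : Matrix (Fin 3) (Fin 3) ℝ}
    (hQ : Q ∈ Matrix.orthogonalGroup (Fin 3) ℝ) : Qᵀ ∈ Matrix.orthogonalGroup (Fin 3) ℝ := by
  simpa [Matrix.star_eq_conjTranspose, Matrix.conjTranspose_eq_transpose_of_trivial] using
    Unitary.star_mem hQ

/-- A matrix with orthogonal columns is an orthogonal matrix times a diagonal one. -/
theorem exists_mul_diagonal_of_transpose_mul_self {A : Matrix (Fin 3) (Fin 3) ℝ}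
    {d : Fin 3 → ℝ} (hA : Aᵀ * A = Matrix.diagonal d) :
    ∃ W ∈ Matrix.orthogonalGroup (Fin 3) ℝ, A = W * Matrix.diagonal fun i => √(d i) := by
  have hAA (i j : Fin 3) : ∑ k, A k i * A k j = if i = j then d i else 0 := by
    simpa [Matrix.mul_apply, Matrix.diagonal_apply] using congrFun (congrFun hA i) j
  have hd (i : Fin 3) : 0 ≤ d i := by
    have := hAA i i
    rw [if_pos rfl] at this
    rw [← this]
    exact Finset.sum_nonneg fun k _ => mul_self_nonneg _
  let v (i : Fin 3) : EuclideanSpace ℝ (Fin 3) := WithLp.toLp 2 fun k => A k i / √(d i)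
  -- Only nonzero columns can be normalised; completing them to an orthonormal basis fills the
  -- remaining places arbitrarily, which is harmless since there both `A` and `√(d i)` vanish.
  let s : Set (Fin 3) := {i | d i ≠ 0}
  have hv : Orthonormal ℝ (s.domRestrict v) := by
    rw [orthonormal_iff_ite]
    rintro ⟨i, hi⟩ ⟨j, hj⟩
    have hin : inner ℝ (v i) (v j) = (∑ k, A k i * A k j) / (√(d i) * √(d j)) := by
      simp only [v, PiLp.inner_apply, RCLike.inner_apply, conj_trivial, Finset.sum_div]
      refine Finset.sum_congr rfl fun k _ => ?_
      rw [div_mul_div_comm, mul_comm (A k j), mul_comm (√(d j))]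
    rw [Set.domRestrict_apply, Set.domRestrict_apply, hin, hAA]
    simp only [Subtype.mk.injEq]
    split_ifs with h
    · subst h
      rw [Real.mul_self_sqrt (hd i), div_self hi]
    · simp
  obtain ⟨b, hb⟩ := hv.exists_orthonormalBasis_extension_of_card_eq (by simp)
  refine ⟨Matrix.of fun k i => b i k, ?_, ?_⟩
  · rw [Matrix.mem_orthogonalGroup_iff']
    ext i j
    have h := orthonormal_iff_ite.1 b.orthonormal i j
    rw [PiLp.inner_apply] at h
    simpa [Matrix.mul_apply, Matrix.one_apply, Matrix.star_eq_conjTranspose, mul_comm] using h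
  · ext k i
    rw [Matrix.mul_diagonal, Matrix.of_apply]
    by_cases hi : d i = 0
    · have h := hAA i i
      rw [if_pos rfl, hi, Finset.sum_eq_zero_iff_of_nonneg fun k _ => mul_self_nonneg _] at h
      simpa [hi] using h k (Finset.mem_univ k)
    · rw [hb i hi]
      have : √(d i) ≠ 0 := (Real.sqrt_pos.2 (lt_of_le_of_ne (hd i) (Ne.symm hi))).ne'
      simp only [v]
      field_simp

/-- Singular value decomposition. -/
theorem exists_eq_mul_diagonal_principalStretches_mul (F : Matrix (Fin 3) (Fin 3) ℝ) :
    ∃ W ∈ Matrix.orthogonalGroup (Fin 3) ℝ, ∃ V ∈ Matrix.orthogonalGroup (Fin 3) ℝ,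
      F = W * Matrix.diagonal (principalStretches F) * V := by
  have hF := Matrix.isHermitian_conjTranspose_mul_self F
  set U : Matrix (Fin 3) (Fin 3) ℝ := hF.eigenvectorUnitary.1
  have hUm : U ∈ Matrix.orthogonalGroup (Fin 3) ℝ := hF.eigenvectorUnitary.2
  have hUU : U * Uᵀ = 1 := by
    simpa [Matrix.star_eq_conjTranspose, Matrix.conjTranspose_eq_transpose_of_trivial] using
      (Matrix.mem_orthogonalGroup_iff (Fin 3) ℝ).1 hUm
  have hUU' : Uᵀ * U = 1 := mul_eq_one_comm.1 hUU
  have hspec : Fᵀ * F = U * Matrix.diagonal hF.eigenvalues * Uᵀ := by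
    have h := hF.spectral_theorem
    rw [Unitary.conjStarAlgAut_apply] at h
    simp only [Matrix.conjTranspose_eq_transpose_of_trivial, Matrix.star_eq_conjTranspose] at h
    exact h
  have hA : (F * U)ᵀ * (F * U) = Matrix.diagonal hF.eigenvalues := by
    calc (F * U)ᵀ * (F * U) = Uᵀ * (Fᵀ * F) * U := by
          simp only [Matrix.transpose_mul, Matrix.mul_assoc]
      _ = (Uᵀ * U) * Matrix.diagonal hF.eigenvalues * (Uᵀ * U) := by
          rw [hspec]; simp only [Matrix.mul_assoc]
      _ = _ := by rw [hUU']; simp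
  obtain ⟨W, hW, hFU⟩ := exists_mul_diagonal_of_transpose_mul_self hA
  refine ⟨W, hW, Uᵀ, transpose_mem_orthogonalGroup hUm, ?_⟩
  calc F = F * U * Uᵀ := by rw [Matrix.mul_assoc, hUU, Matrix.mul_one]
    _ = _ := by rw [hFU]; rfl

theorem principalStretches_nonneg (F : Matrix (Fin 3) (Fin 3) ℝ) (i : Fin 3) :
    0 ≤ principalStretches F i :=
  Real.sqrt_nonneg _

theorem abs_det_of_mem_orthogonalGroup {Q : Matrix (Fin 3) (Fin 3) ℝ}
    (hQ : Q ∈ Matrix.orthogonalGroup (Fin 3) ℝ) : |Q.det| = 1 := by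
  rw [← Real.sqrt_sq_eq_abs, det_sq_of_mem_orthogonalGroup hQ, Real.sqrt_one]

/-- The orthogonal factors have determinant `±1` of unknown sign, so absolute values are compared.
-/
theorem prod_principalStretches {F : Matrix (Fin 3) (Fin 3) ℝ} (hF : 0 ≤ F.det) :
    principalStretches F 0 * principalStretches F 1 * principalStretches F 2 = F.det := by
  obtain ⟨W, hW, V, hV, h⟩ := exists_eq_mul_diagonal_principalStretches_mul F
  have h' := congrArg (fun A => |Matrix.det A|) h
  simp only [Matrix.det_mul, abs_mul, abs_det_of_mem_orthogonalGroup hW,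
    abs_det_of_mem_orthogonalGroup hV, Matrix.det_diagonal, Fin.prod_univ_three,
    abs_of_nonneg (principalStretches_nonneg F _), abs_of_nonneg hF, one_mul, mul_one] at h'
  exact h'.symm

end Orthogonal

/-! ### The polyconvex representative and its evaluation. -/

/-- The linear map `(F, G, δ) ↦ (diag (Q F R), diag (cof Q G cof R), δ)`. -/
def rotatedDiagonals (Q R : Matrix (Fin 3) (Fin 3) ℝ) :
    Matrix (Fin 3) (Fin 3) ℝ × Matrix (Fin 3) (Fin 3) ℝ × ℝ →ₗ[ℝ]
      (Fin 3 → ℝ) × (Fin 3 → ℝ) × ℝ where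
  toFun p := ((Q * p.1 * R).diag, (cofactorMatrix Q * p.2.1 * cofactorMatrix R).diag, p.2.2)
  map_add' p q := by simp [Matrix.mul_add, Matrix.add_mul]
  map_smul' c p := by simp

theorem continuous_rotatedDiagonals (Q R : Matrix (Fin 3) (Fin 3) ℝ) :
    Continuous (rotatedDiagonals Q R) :=
  show Continuous fun p : Matrix (Fin 3) (Fin 3) ℝ × Matrix (Fin 3) (Fin 3) ℝ × ℝ =>
    ((Q * p.1 * R).diag, (cofactorMatrix Q * p.2.1 * cofactorMatrix R).diag, p.2.2) by
  fun_prop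

theorem isClosed_ballDomain : IsClosed ballDomain :=
  isClosed_le continuous_const (by fun_prop)

/-- A convex function which is bounded by `c` at all simultaneous permutations of `(x, y)` is
bounded by `c` at `(B x, B y)` for doubly stochastic `B`. -/
theorem ExtConvexOn.le_of_mem_doublyStochastic
    {f : (Fin 3 → ℝ) × (Fin 3 → ℝ) × ℝ → WithTop ℝ} (hf : ExtConvexOn ballDomain f)
    {x y : Fin 3 → ℝ} {δ : ℝ} (hδ : 0 ≤ δ) {c : WithTop ℝ}
    (hc : ∀ σ : Equiv.Perm (Fin 3), f (x ∘ σ, y ∘ σ, δ) ≤ c)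
    {B : Matrix (Fin 3) (Fin 3) ℝ} (hB : B ∈ doublyStochastic ℝ (Fin 3)) :
    f (B *ᵥ x, B *ᵥ y, δ) ≤ c := by
  have hconv : Convex ℝ {B : Matrix (Fin 3) (Fin 3) ℝ | f (B *ᵥ x, B *ᵥ y, δ) ≤ c} := by
    intro B hB C hC a b ha hb hab
    have h := (hf.convex_le c) (x := (B *ᵥ x, B *ᵥ y, δ)) ⟨hδ, hB⟩
      (y := (C *ᵥ x, C *ᵥ y, δ)) ⟨hδ, hC⟩ ha hb hab
    have hδ' : a * δ + b * δ = δ := by rw [← add_mul, hab, one_mul]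
    simpa [Matrix.add_mulVec, Matrix.smul_mulVec, hδ'] using h.2
  have hB' : B ∈ (doublyStochastic ℝ (Fin 3) : Set (Matrix (Fin 3) (Fin 3) ℝ)) := hB
  -- Birkhoff's theorem reduces the bound to permutation matrices.
  rw [doublyStochastic_eq_convexHull_permMatrix] at hB'
  refine convexHull_min ?_ hconv hB'
  rintro _ ⟨σ, rfl⟩
  simpa [Matrix.permMatrix_mulVec] using hc σ

theorem mainTheorem3
    (Ψ : Matrix (Fin 3) (Fin 3) ℝ → WithTop ℝ)
    (Ψbreve : (Fin 3 → ℝ) → WithTop ℝ)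
    (ΨBall : (Fin 3 → ℝ) × (Fin 3 → ℝ) × ℝ → WithTop ℝ)
    -- `ΨBall` is convex and lower semicontinuous on `ℝ⁶ × [0, ∞)`
    (hconv : ExtConvexOn ballDomain ΨBall)
    (hlsc : LowerSemicontinuousOn ΨBall ballDomain)
    -- and non-decreasing in each of its first six arguments
    (hmono₁ : ∀ (x y : Fin 3 → ℝ) (δ : ℝ), 0 ≤ δ → ∀ i : Fin 3,
      Monotone fun t : ℝ => ΨBall (Function.update x i t, y, δ))
    (hmono₂ : ∀ (x y : Fin 3 → ℝ) (δ : ℝ), 0 ≤ δ → ∀ i : Fin 3,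
      Monotone fun t : ℝ => ΨBall (x, Function.update y i t, δ))
    -- the function of the principal stretches induced on `[0, ∞)³`
    (hbreve : ∀ l : Fin 3 → ℝ, (∀ i, 0 ≤ l i) →
      Ψbreve l = ΨBall (l, pairProducts l, l 0 * l 1 * l 2))
    -- is invariant under permutations
    (hperm : ∀ (σ : Equiv.Perm (Fin 3)) (l : Fin 3 → ℝ), (∀ i, 0 ≤ l i) →
      Ψbreve (l ∘ σ) = Ψbreve l)
    -- and gives `Ψ F` if `det F ≥ 0`, while `Ψ F = ∞` if `det F < 0`
    (hΨ : ∀ F : Matrix (Fin 3) (Fin 3) ℝ, 0 ≤ F.det → Ψ F = Ψbreve (principalStretches F))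
    (hΨtop : ∀ F : Matrix (Fin 3) (Fin 3) ℝ, F.det < 0 → Ψ F = ⊤) :
    IsPolyconvex Ψ := by

  let O := Matrix.orthogonalGroup (Fin 3) ℝ
  let f (q : O × O) := extendByTop ballDomain ΨBall ∘ rotatedDiagonals q.1 q.2
  have hlub (p) : IsLUB (Set.range fun q => f q p) (⨆ q, f q p) :=
    WithTop.isLUB_sSup' (Set.range_nonempty _)
  refine ⟨fun p => ⨆ q, f q p,
    ExtConvexOn.iSup fun q => hconv.extendByTop.comp_linearMap _,
    lowerSemicontinuous_iSup_withTop fun q =>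
      (LowerSemicontinuousOn.extendByTop isClosed_ballDomain hlsc).comp
        (continuous_rotatedDiagonals _ _),
    fun F => ?_⟩
  rcases lt_or_ge F.det 0 with hF | hF
  · rw [hΨtop F hF]
    refine le_antisymm ((hlub _).1 ⟨1, ?_⟩) le_top
    -- The component `δ = det F` is not rotated, so the point lies outside `ballDomain`.
    exact if_neg (not_le.2 hF)
  · have hfF (q : O × O) : f q (F, cofactorMatrix F, F.det) =
        ΨBall ((q.1.1 * F * q.2.1).diag,
          (cofactorMatrix (q.1.1 * F * q.2.1)).diag, F.det) := by
      rw [cofactorMatrix_mul, cofactorMatrix_mul]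
      exact if_pos hF
    set l := principalStretches F with hl
    have hl0 : ∀ i, 0 ≤ l i := principalStretches_nonneg F
    have hm0 : ∀ i, 0 ≤ pairProducts l i := by
      intro i
      fin_cases i <;> exact mul_nonneg (hl0 _) (hl0 _)
    have hdet : l 0 * l 1 * l 2 = F.det := prod_principalStretches hF
    have hperm' (σ : Equiv.Perm (Fin 3)) :
        ΨBall (l ∘ σ, pairProducts l ∘ σ, F.det) = Ψbreve l := by
      rw [← hperm σ l hl0, hbreve (l ∘ σ) fun i => hl0 (σ i), pairProducts_comp, ← hdet]
      have : l 0 * l 1 * l 2 = l (σ 0) * l (σ 1) * l (σ 2) := by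
        simpa [Fin.prod_univ_three] using (Equiv.prod_comp σ l).symm
      rw [this]
      rfl
    obtain ⟨W, hW, V, hV, hsvd⟩ := exists_eq_mul_diagonal_principalStretches_mul F
    rw [← hl] at hsvd
    rw [hΨ F hF]
    refine le_antisymm ((hlub _).1 ⟨(⟨Wᵀ, transpose_mem_orthogonalGroup hW⟩,
      ⟨Vᵀ, transpose_mem_orthogonalGroup hV⟩), ?_⟩) ((hlub _).2 ?_)
    · have hdiag : Wᵀ * F * Vᵀ = Matrix.diagonal l := by
        calc Wᵀ * F * Vᵀ = (Wᵀ * W) * Matrix.diagonal l * (V * Vᵀ) := by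
              rw [hsvd]; simp only [Matrix.mul_assoc]
          _ = _ := by
              rw [(Matrix.mem_orthogonalGroup_iff' (Fin 3) ℝ).1 hW,
                (Matrix.mem_orthogonalGroup_iff (Fin 3) ℝ).1 hV, one_mul, mul_one]
      refine (hfF _).trans ?_
      rw [hdiag, cofactorMatrix_diagonal, Matrix.diag_diagonal, Matrix.diag_diagonal]
      exact hperm' 1
    · rintro _ ⟨⟨⟨Q, hQ⟩, ⟨R, hR⟩⟩, rfl⟩
      refine (hfF _).trans_le ?_
      have hQW : Q * W ∈ Matrix.orthogonalGroup (Fin 3) ℝ := mul_mem hQ hW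
      have hVR : V * R ∈ Matrix.orthogonalGroup (Fin 3) ℝ := mul_mem hV hR
      have hQR : Q * F * R = (Q * W) * Matrix.diagonal l * (V * R) := by
        rw [hsvd]; simp only [Matrix.mul_assoc]
      have h₁ : (Q * F * R).diag ≤ meanSquares (Q * W) (V * R) *ᵥ l := by
        rw [hQR]; exact diag_mul_diagonal_mul_le _ _ hl0
      have h₂ : (cofactorMatrix (Q * F * R)).diag ≤
          meanSquares (Q * W) (V * R) *ᵥ pairProducts l := by
        rw [hQR, cofactorMatrix_mul, cofactorMatrix_mul, cofactorMatrix_diagonal,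
          ← meanSquares_cofactorMatrix hQW hVR]
        exact diag_mul_diagonal_mul_le _ _ hm0
      have hmono_x (y : Fin 3 → ℝ) : Monotone fun x => ΨBall (x, y, F.det) :=
        monotone_of_monotone_update fun x i => hmono₁ x y _ hF i
      have hmono_y (x : Fin 3 → ℝ) : Monotone fun y => ΨBall (x, y, F.det) :=
        monotone_of_monotone_update fun y i => hmono₂ x y _ hF i
      refine (hmono_x _ h₁).trans <| (hmono_y _ h₂).trans ?_
      exact hconv.le_of_mem_doublyStochastic hF (fun σ => (hperm' σ).le)
        (meanSquares_mem_doublyStochastic hQW hVR)
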